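/- Let $x=(x_1,x_2,\dots)$, $y=(y_1,y_2,\dots)$. For elements $t=(t_1,t_2,\dots)$ that commute pairwise, the elementary Schur polynomials $S_k(t)$ ($k\ge 0$) are defined by $\sum_{k\ge0}S_k(t)z^k=\exp\left(\sum_{n\ge1}t_nz^n\right)$. On the completed bosonic Fock space $\mathcal B=\mathbb C[[x,y;p,p^{-1}]]$ consider the charged free bosons $\varphi^*(z)=\sum_{i\in\mathbb Z}\varphi^*_iz^{-i}$ and $\varphi(z)=\sum_{i\in\mathbb Z}\varphi_iz^{-i-1}$ acting by $$\varphi^{*}(z)=p\,\exp\Big(\sum_{n>0}(x_n+y_n)z^n\Big)\Big(\sum_{k>0}kx_kz^{k-1}+\sum_{k>0}\partial_{x_k}z^{-k-1}+p\,\partial_p\,z^{-1}\Big)\exp\Big(-\sum_{n>0}(\partial_{x_n}-\partial_{y_n})\frac{z^{-n}}{n}\Big),$$ $$\varphi(z)=p^{-1}\exp\Big(-\sum_{n>0}(x_n+y_n)z^n\Big)\exp\Big(\sum_{n>0}(\partial_{x_n}-\partial_{y_n})\frac{z^{-n}}{n}\Big).$$ A tau function is a solution $\tau\in\mathcal B$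 of the Hirota equation $\Omega_U(\tau\otimes\tau)=0$ in the completed tensor square of $\mathcal B$, where $\Omega_U=\mathrm{Res}_z\,\varphi^*(z)\otimes\varphi(z)=\sum_{i\in\mathbb Z}\varphi^*_i\otimes\varphi_{-i}$. **Proposition.** Let $\tau\in\mathbb C[[x,y]]\subset\mathcal B$ be a tau function. Then, in $\mathbb C[[x,y,\bar x,\bar y]]$, where $\bar x=(\bar x_1,\bar x_2,\dots)$ and $\bar y=(\bar y_1,\bar y_2,\dots)$ are further independent variables, $$\sum_{i,j\ge0}S_i(2x+2y)\Big[(j-i)(x_{j-i}+\bar x_{j-i})+\tfrac12\big(\partial_{\lambda_{i-j}}+\partial_{\bar x_{i-j}}\big)\Big]S_j\big(-\widetilde\partial_\lambda+\widetilde\partial_\mu\big)\exp\Big(\sum_{l\ge1}(x_l\partial_{\lambda_l}+y_l\partial_{\mu_l})\Big)\,\tau(\bar x-\lambda,\bar y-\mu)\,\tau(\bar x+\lambda,\bar y+\mu)\Big|_{\lambda=\mu=0}=0,$$ where $\lambda=(\lambda_1,\lambda_2,\dots)$, $\mu=(\mu_1,\mu_2,\dots)$ are auxiliary variables, $\widetilde\partial_\lambda=\big(\partial_{\lambda_1},\tfrac12\partial_{\lambda_2},\tfrac13\partial_{\lambda_3},\dots\big)$,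 similarly $\widetilde\partial_\mu$, and $x_k$, $\bar x_k$, $\partial_{\lambda_k}$, $\partial_{\bar x_k}$ are read as $0$ for $k\le0$. The sum over $(i,j)$ is locally finite: every monomial in $x,y,\bar x,\bar y$ has a nonzero coefficient in only finitely many of its terms. -/

import Mathlib

noncomputable section

namespace BosonicTau

/-! ### Formal sums, elementary Schur polynomials, derivatives -/

/-- A family of formal power series is locally finite if every monomial occurs in only finitely
many members of the family; this is what makes its sum meaningful. -/
def LocallyFinite {σ ι : Type*} (f : ι → MvPowerSeries σ ℂ) : Prop :=
  ∀ d : σ →₀ ℕ, {i | MvPowerSeries.coeff d (f i) ≠ 0}.Finite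

/-- The coefficientwise sum of a (locally finite) family of formal power series. -/
def formalSum {σ ι : Type*} (f : ι → MvPowerSeries σ ℂ) : MvPowerSeries σ ℂ :=
  fun d => ∑ᶠ i, MvPowerSeries.coeff d (f i)

/-- Extension by zero to integer indices of a family indexed by the positive integers. -/
def extZ {A : Type*} [Zero A] (t : ℕ+ → A) (n : ℤ) : A :=
  if h : 0 < n then t (n.toNat.toPNat (by omega)) else 0

/-- The power series `∑_{n ≥ 1} t_n z ^ n` in the auxiliary variable `z`. -/
def genSeries {A : Type*} [Semiring A] (t : ℕ+ → A) : PowerSeries A :=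
  PowerSeries.mk fun n => extZ t n

/-- The elementary Schur polynomial `S_k` evaluated at pairwise commuting elements
`t_1, t_2, …` of a `ℂ`-algebra: the coefficient of `z ^ k` in
`exp (∑_{n ≥ 1} t_n z ^ n) = ∑_r (∑_{n ≥ 1} t_n z ^ n) ^ r / r!`.
Only `r ≤ k` can contribute, because the series has no constant term. -/
def elemSchur {A : Type*} [Ring A] [Algebra ℂ A] (t : ℕ+ → A) (k : ℕ) : A :=
  ∑ r ∈ Finset.range (k + 1), ((r.factorial : ℂ)⁻¹) • PowerSeries.coeff k (genSeries t ^ r)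

/-- The partial derivative with respect to the variable `v`, as a linear operator. -/
def D {σ : Type*} (v : σ) : Module.End ℂ (MvPowerSeries σ ℂ) :=
  (MvPowerSeries.pderiv ℂ v).toLinearMap

/-! ### The bosonic Fock space and the charged free bosons acting on it -/

/-- The variables `x_1, x_2, …` and `y_1, y_2, …`. -/
inductive BosVar : Type
  | x (n : ℕ+)
  | y (n : ℕ+)

/-- The algebra `ℂ[[x, y]]`. -/
abbrev CXY : Type := MvPowerSeries BosVar ℂ

/-- The completed bosonic Fock space `ℂ[[x, y; p, p⁻¹]]`; the element `f` stands for
`∑_{l ∈ ℤ} f_l p ^ l` with `f_l = f l ∈ ℂ[[x, y]]`. -/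
abbrev Fock : Type := ℤ → CXY

/-- The inclusion of `ℂ[[x, y]]` into the Fock space, as the part of degree `0` in `p`. -/
def ofCXY (τ : CXY) : Fock := Pi.single 0 τ

/-- The Heisenberg mode `α_n` on the component `ℂ[[x, y]] p ^ l`: it is `∂/∂x_n` for `n > 0`,
multiplication by `k x_k` for `n = -k < 0`, and `p ∂/∂p`, that is the scalar `l`, for `n = 0`. -/
def alphaMode (l n : ℤ) (f : CXY) : CXY :=
  extZ (fun k => D (BosVar.x k)) n f
    + extZ (fun k => ((k : ℕ) : ℂ) • MvPowerSeries.X (BosVar.x k)) (-n) * f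
    + (if n = 0 then (l : ℂ) • f else 0)

/-- `x_n + y_n`. -/
def xPlusY (n : ℕ+) : CXY := MvPowerSeries.X (BosVar.x n) + MvPowerSeries.X (BosVar.y n)

/-- `(∂/∂x_n - ∂/∂y_n) / n`. -/
def dxMinusDy (n : ℕ+) : Module.End ℂ CXY :=
  (((n : ℕ) : ℂ)⁻¹) • (D (BosVar.x n) - D (BosVar.y n))

/-- The summands of `(φ*_m f)_l`. In
`p exp(∑ (x_n + y_n) z ^ n) (∑_k α_k z ^ (-k-1)) exp(-∑ (∂x_n - ∂y_n) z ^ (-n) / n)`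
the summand `(a, b)` comes from `z ^ a` in the first and `z ^ (-b)` in the last exponential, so
that the power `z ^ (-m)` is reached exactly for `k = a - b + m - 1`. -/
def phiStarTerm (m : ℤ) (f : Fock) (l : ℤ) (ab : ℕ × ℕ) : CXY :=
  elemSchur xPlusY ab.1 *
    alphaMode (l - 1) ((ab.1 : ℤ) - ab.2 + m - 1) (elemSchur (-dxMinusDy) ab.2 (f (l - 1)))

/-- The mode `φ*_m`, the coefficient of `z ^ (-m)` in the field
`φ*(z) = p exp(∑_{n>0} (x_n + y_n) z ^ n)
  (∑_{k>0} k x_k z ^ (k-1) + ∑_{k>0} ∂x_k z ^ (-k-1) + p ∂p z ^ (-1))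
  exp(-∑_{n>0} (∂x_n - ∂y_n) z ^ (-n) / n)`. -/
def phiStar (m : ℤ) (f : Fock) : Fock := fun l => formalSum (phiStarTerm m f l)

/-- The summands of `(φ_m f)_l`: `z ^ a` from the first and `z ^ (-b)` from the second exponential
give `z ^ (-m-1)` exactly for `b = a + m + 1`. -/
def phiTerm (m : ℤ) (f : Fock) (l : ℤ) (ab : ℕ × ℕ) : CXY :=
  if (ab.2 : ℤ) = ab.1 + m + 1 then
    elemSchur (-xPlusY) ab.1 * elemSchur dxMinusDy ab.2 (f (l + 1))
  else 0

/-- The mode `φ_m`, the coefficient of `z ^ (-m-1)` in the field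
`φ(z) = p⁻¹ exp(-∑_{n>0} (x_n + y_n) z ^ n) exp(∑_{n>0} (∂x_n - ∂y_n) z ^ (-n) / n)`. -/
def phi (m : ℤ) (f : Fock) : Fock := fun l => formalSum (phiTerm m f l)

/-! ### The Hirota equation -/

/-- The completed tensor square of the Fock space: the element `F` stands for
`∑_{l, l'} F_{l, l'} p' ^ l p'' ^ l'` with `F_{l, l'} ∈ ℂ[[x', y', x'', y'']]`, where
`Sum.inl` marks the variables of the first factor and `Sum.inr` those of the second one. -/
abbrev Fock2 : Type := ℤ → ℤ → MvPowerSeries (BosVar ⊕ BosVar) ℂ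

/-- The pure tensor `f ⊗ g = f(x', y', p') g(x'', y'', p'')`. -/
def tensor (f g : Fock) : Fock2 := fun l l' =>
  MvPowerSeries.subst (fun v => MvPowerSeries.X (Sum.inl v)) (f l) *
    MvPowerSeries.subst (fun v => MvPowerSeries.X (Sum.inr v)) (g l')

/-- `Ω_U (f ⊗ g)`, where `Ω_U = Res_z φ*(z) ⊗ φ(z) = ∑_{i ∈ ℤ} φ*_i ⊗ φ_{-i}`. -/
def omegaU (f g : Fock) : Fock2 := fun l l' =>
  formalSum fun i : ℤ => tensor (phiStar i f) (phi (-i) g) l l'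

/-- Tau functions are the solutions of the Hirota equation `Ω_U (τ ⊗ τ) = 0`. -/
def IsTau (τ : Fock) : Prop := omegaU τ τ = 0

/-! ### The bilinear equations -/

/-- The variables `x_n, y_n, x̄_n, ȳ_n` of the bilinear equations. -/
inductive EqVar : Type
  | x (n : ℕ+)
  | y (n : ℕ+)
  | xbar (n : ℕ+)
  | ybar (n : ℕ+)

/-- The variables `x, y, x̄, ȳ` together with the auxiliary variables `λ, μ`. -/
abbrev HirVar : Type := EqVar ⊕ BosVar

abbrev vx (n : ℕ+) : HirVar := Sum.inl (EqVar.x n)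
abbrev vy (n : ℕ+) : HirVar := Sum.inl (EqVar.y n)
abbrev vxbar (n : ℕ+) : HirVar := Sum.inl (EqVar.xbar n)
abbrev vybar (n : ℕ+) : HirVar := Sum.inl (EqVar.ybar n)
abbrev vlam (n : ℕ+) : HirVar := Sum.inr (BosVar.x n)
abbrev vmu (n : ℕ+) : HirVar := Sum.inr (BosVar.y n)

/-- The algebra `ℂ[[x, y, x̄, ȳ, λ, μ]]`. -/
abbrev CHir : Type := MvPowerSeries HirVar ℂ

/-- The substitution `(x, y) ↦ (x̄ + λ, ȳ + μ)`. -/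
def plusVar : BosVar → CHir
  | BosVar.x n => MvPowerSeries.X (vxbar n) + MvPowerSeries.X (vlam n)
  | BosVar.y n => MvPowerSeries.X (vybar n) + MvPowerSeries.X (vmu n)

/-- The substitution `(x, y) ↦ (x̄ - λ, ȳ - μ)`. -/
def minusVar : BosVar → CHir
  | BosVar.x n => MvPowerSeries.X (vxbar n) - MvPowerSeries.X (vlam n)
  | BosVar.y n => MvPowerSeries.X (vybar n) - MvPowerSeries.X (vmu n)

/-- `τ(x̄ - λ, ȳ - μ) τ(x̄ + λ, ȳ + μ)`. -/
def twoPoint (τ : CXY) : CHir :=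
  MvPowerSeries.subst minusVar τ * MvPowerSeries.subst plusVar τ

/-- The operator `∑_{l ≥ 1} (x_l ∂/∂λ_l + y_l ∂/∂μ_l)`. -/
def shiftOp (F : CHir) : CHir :=
  formalSum fun l : ℕ+ =>
    MvPowerSeries.X (vx l) * D (vlam l) F + MvPowerSeries.X (vy l) * D (vmu l) F

/-- The operator `exp (∑_{l ≥ 1} (x_l ∂/∂λ_l + y_l ∂/∂μ_l))`. -/
def expShift (F : CHir) : CHir :=
  formalSum fun r : ℕ => ((r.factorial : ℂ)⁻¹) • shiftOp^[r] F

/-- `2 x_n + 2 y_n`. -/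
def twoXY (n : ℕ+) : CHir :=
  (2 : ℂ) • MvPowerSeries.X (vx n) + (2 : ℂ) • MvPowerSeries.X (vy n)

/-- `-(∂/∂λ_n) / n + (∂/∂μ_n) / n`, the `n`-th entry of `-∂̃λ + ∂̃μ`. -/
def tildeD (n : ℕ+) : Module.End ℂ CHir :=
  -((((n : ℕ) : ℂ)⁻¹) • D (vlam n)) + (((n : ℕ) : ℂ)⁻¹) • D (vmu n)

/-- The operator `(j - i) (x_{j-i} + x̄_{j-i}) + (∂/∂λ_{i-j} + ∂/∂x̄_{i-j}) / 2`, where variables and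
derivatives with an index `≤ 0` are zero. -/
def bracket (i j : ℕ) (F : CHir) : CHir :=
  (((j : ℤ) - i : ℤ) : ℂ) •
      (extZ (fun k => (MvPowerSeries.X (vx k) + MvPowerSeries.X (vxbar k) : CHir)) ((j : ℤ) - i) * F)
    + (2 : ℂ)⁻¹ • extZ (fun k => D (vlam k) + D (vxbar k)) ((i : ℤ) - j) F

/-- The `(i, j)` summand of the bilinear equation, before `λ = μ = 0` is imposed. -/
def hirotaTerm (τ : CXY) (i j : ℕ) : CHir :=
  elemSchur twoXY i * bracket i j (elemSchur tildeD j (expShift (twoPoint τ)))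

/-- Evaluation at `λ = μ = 0`. -/
def atZero (F : CHir) : MvPowerSeries EqVar ℂ :=
  MvPowerSeries.killCompl (Function.Embedding.inl : EqVar ↪ HirVar) F


/-! ### Well-definedness: the substitutions are legitimate and all formal sums locally finite -/

/-- The grading in which `x_n` and `y_n` have weight `n`. -/
def bosWt : BosVar → ℕ
  | BosVar.x n => n
  | BosVar.y n => n

/-- `F` has no monomial of weight less than `k`. -/
def LowWt {σ : Type*} (w : σ → ℕ) (k : ℕ) (F : MvPowerSeries σ ℂ) : Prop :=
  ∀ d, MvPowerSeries.coeff d F ≠ 0 → k ≤ Finsupp.weight w d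

theorem LowWt.mul {σ : Type*} {w : σ → ℕ} {k l : ℕ} {F G : MvPowerSeries σ ℂ}
    (hF : LowWt w k F) (hG : LowWt w l G) : LowWt w (k + l) (F * G) := by
  classical
  intro d hd
  rw [MvPowerSeries.coeff_mul] at hd
  obtain ⟨p, hp, hne⟩ := Finset.exists_ne_zero_of_sum_ne_zero hd
  rw [Finset.HasAntidiagonal.mem_antidiagonal] at hp
  rw [← hp, map_add]
  exact Nat.add_le_add (hF _ (left_ne_zero_of_mul hne)) (hG _ (right_ne_zero_of_mul hne))

theorem LowWt.sum {σ ι : Type*} {w : σ → ℕ} {k : ℕ} {s : Finset ι} {F : ι → MvPowerSeries σ ℂ}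
    (hF : ∀ i ∈ s, LowWt w k (F i)) : LowWt w k (∑ i ∈ s, F i) := by
  intro d hd
  rw [map_sum] at hd
  obtain ⟨i, hi, hne⟩ := Finset.exists_ne_zero_of_sum_ne_zero hd
  exact hF i hi d hne

theorem LowWt.smul {σ : Type*} {w : σ → ℕ} {k : ℕ} {F : MvPowerSeries σ ℂ} (c : ℂ)
    (hF : LowWt w k F) : LowWt w k (c • F) := by
  intro d hd
  rw [map_smul, smul_eq_mul] at hd
  exact hF d (right_ne_zero_of_mul hd)

theorem LowWt.add {σ : Type*} {w : σ → ℕ} {k : ℕ} {F G : MvPowerSeries σ ℂ}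
    (hF : LowWt w k F) (hG : LowWt w k G) : LowWt w k (F + G) := by
  intro d hd
  by_contra hlt
  have h1 : MvPowerSeries.coeff d F = 0 := by
    by_contra h; exact hlt (hF d h)
  have h2 : MvPowerSeries.coeff d G = 0 := by
    by_contra h; exact hlt (hG d h)
  exact hd (by rw [map_add, h1, h2, add_zero])

theorem lowWt_X {σ : Type*} (w : σ → ℕ) (v : σ) :
    LowWt w (w v) (MvPowerSeries.X v : MvPowerSeries σ ℂ) := by
  classical
  intro d hd
  rw [MvPowerSeries.coeff_X] at hd
  have h : d = Finsupp.single v 1 := by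
    by_contra h; exact hd (if_neg h)
  simp [h, Finsupp.weight_single]

/-- If `t_n` has only monomials of weight at least `n`, then `S_k(t)` has only monomials of weight
at least `k`. -/
theorem lowWt_elemSchur {σ : Type*} {w : σ → ℕ} {t : ℕ+ → MvPowerSeries σ ℂ}
    (ht : ∀ n : ℕ+, LowWt w n (t n)) (k : ℕ) : LowWt w k (elemSchur t k) := by
  have key : ∀ r k, LowWt w k (PowerSeries.coeff k (genSeries t ^ r)) := by
    intro r
    induction r with
    | zero =>
      intro k d hd
      rw [pow_zero, PowerSeries.coeff_one] at hd
      by_cases hk : k = 0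
      · simp [hk]
      · simp [hk] at hd
    | succ r ih =>
      intro k
      rw [pow_succ, PowerSeries.coeff_mul]
      refine LowWt.sum fun p hp => ?_
      rw [← Finset.HasAntidiagonal.mem_antidiagonal.mp hp]
      refine (ih p.1).mul ?_
      rw [genSeries, PowerSeries.coeff_mk, extZ]
      split_ifs with h
      · exact ht (((p.2 : ℕ) : ℤ).toNat.toPNat (by omega))
      · intro d hd
        simp at hd
  exact LowWt.sum fun r _ => (key r k).smul _

theorem lowWt_xPlusY (n : ℕ+) : LowWt bosWt n (xPlusY n) :=
  (lowWt_X bosWt (BosVar.x n)).add (lowWt_X bosWt (BosVar.y n))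

theorem lowWt_neg_xPlusY (n : ℕ+) : LowWt bosWt n ((-xPlusY) n) := by
  have h := (lowWt_xPlusY n).smul (-1)
  rwa [neg_one_smul] at h

/-- For `n < 0`, the mode `α_n` produces only monomials of weight at least `-n`. -/
theorem lowWt_alphaMode (l n : ℤ) (f : CXY) : LowWt bosWt (-n).toNat (alphaMode l n f) := by
  by_cases h : 0 < -n
  · have h1 : ¬ 0 < n := by omega
    have h2 : n ≠ 0 := by omega
    rw [alphaMode, extZ, dif_neg h1, extZ, dif_pos h, if_neg h2, add_zero, LinearMap.zero_apply,
      zero_add]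
    have hz : LowWt bosWt 0 f := fun _ _ => Nat.zero_le _
    exact ((lowWt_X bosWt (BosVar.x ((-n).toNat.toPNat (by omega)))).smul _).mul hz
  · intro d _
    omega

theorem phiStarTerm_bound {m : ℤ} {f : Fock} {l : ℤ} {ab : ℕ × ℕ} {d : BosVar →₀ ℕ}
    (h : MvPowerSeries.coeff d (phiStarTerm m f l ab) ≠ 0) :
    ab.1 ≤ Finsupp.weight bosWt d ∧ (ab.2 : ℤ) + 1 - m ≤ Finsupp.weight bosWt d := by
  have h1 := ((lowWt_elemSchur lowWt_xPlusY ab.1).mul (lowWt_alphaMode (l - 1)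
    ((ab.1 : ℤ) - ab.2 + m - 1) (elemSchur (-dxMinusDy) ab.2 (f (l - 1))))) d h
  omega

theorem locallyFinite_phiStarTerm (m : ℤ) (f : Fock) (l : ℤ) :
    LocallyFinite (phiStarTerm m f l) := by
  intro d
  refine ((Finset.range (Finsupp.weight bosWt d + 1)) ×ˢ
    (Finset.range ((Finsupp.weight bosWt d : ℤ) + m).toNat)).finite_toSet.subset ?_
  intro ab h
  have := phiStarTerm_bound h
  simp only [Finset.coe_product, Set.mem_prod, Finset.mem_coe, Finset.mem_range]
  omega

theorem phiTerm_bound {m : ℤ} {f : Fock} {l : ℤ} {ab : ℕ × ℕ} {d : BosVar →₀ ℕ}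
    (h : MvPowerSeries.coeff d (phiTerm m f l ab) ≠ 0) :
    (ab.2 : ℤ) = ab.1 + m + 1 ∧ ab.1 ≤ Finsupp.weight bosWt d := by
  rw [phiTerm] at h
  split_ifs at h with hab
  · refine ⟨hab, ?_⟩
    have hz : LowWt bosWt 0 (elemSchur dxMinusDy ab.2 (f (l + 1))) := fun _ _ => Nat.zero_le _
    have := ((lowWt_elemSchur lowWt_neg_xPlusY ab.1).mul hz) d h
    omega
  · simp at h

theorem locallyFinite_phiTerm (m : ℤ) (f : Fock) (l : ℤ) : LocallyFinite (phiTerm m f l) := by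
  intro d
  refine ((Finset.range (Finsupp.weight bosWt d + 1)) ×ˢ
    (Finset.range ((Finsupp.weight bosWt d : ℤ) + m + 2).toNat)).finite_toSet.subset ?_
  intro ab h
  have := phiTerm_bound h
  simp only [Finset.coe_product, Set.mem_prod, Finset.mem_coe, Finset.mem_range]
  omega

theorem exists_of_coeff_formalSum {σ ι : Type*} {f : ι → MvPowerSeries σ ℂ} {d : σ →₀ ℕ}
    (h : MvPowerSeries.coeff d (formalSum f) ≠ 0) : ∃ i, MvPowerSeries.coeff d (f i) ≠ 0 := by
  by_contra hne
  push Not at hne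
  exact h (finsum_eq_zero_of_forall_eq_zero hne)

theorem weight_of_coeff_subst {g : BosVar → BosVar ⊕ BosVar} (hg : Function.Injective g)
    (hw : ∀ v, Sum.elim bosWt bosWt (g v) = bosWt v) {f : CXY} {d : BosVar ⊕ BosVar →₀ ℕ}
    (h : MvPowerSeries.coeff d (MvPowerSeries.subst
      (fun v => (MvPowerSeries.X (g v) : MvPowerSeries (BosVar ⊕ BosVar) ℂ)) f) ≠ 0) :
    ∃ e, Finsupp.weight bosWt e = Finsupp.weight (Sum.elim bosWt bosWt) d ∧
      MvPowerSeries.coeff e f ≠ 0 := by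
  have : Filter.TendstoCofinite g := ⟨hg.tendsto_cofinite⟩
  have h2 : MvPowerSeries.subst
      (fun v => (MvPowerSeries.X (g v) : MvPowerSeries (BosVar ⊕ BosVar) ℂ)) f
      = MvPowerSeries.rename g f := (MvPowerSeries.rename_eq_subst g f).symm
  rw [h2, MvPowerSeries.coeff_rename] at h
  obtain ⟨e, he, hne⟩ := Finset.exists_ne_zero_of_sum_ne_zero h
  refine ⟨e, ?_, hne⟩
  have he2 : Finsupp.mapDomain g e = d := by simpa using he
  rw [← he2, Finsupp.weight_apply, Finsupp.weight_apply, Finsupp.sum_mapDomain_index] <;>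
    simp [hw, add_mul]

theorem locallyFinite_omegaU (f g : Fock) (l l' : ℤ) :
    LocallyFinite fun i : ℤ => tensor (phiStar i f) (phi (-i) g) l l' := by
  classical
  intro d
  set N := Finsupp.weight (Sum.elim bosWt bosWt) d with hN
  refine (Finset.Icc (1 - (N : ℤ)) (N + 1)).finite_toSet.subset ?_
  intro i h
  simp only [Set.mem_ofPred_eq, tensor] at h
  rw [MvPowerSeries.coeff_mul] at h
  obtain ⟨q, hq, hne⟩ := Finset.exists_ne_zero_of_sum_ne_zero h
  obtain ⟨e, he, he0⟩ := weight_of_coeff_subst Sum.inl_injective (fun _ => rfl)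
    (left_ne_zero_of_mul hne)
  obtain ⟨e', he', he0'⟩ := weight_of_coeff_subst Sum.inr_injective (fun _ => rfl)
    (right_ne_zero_of_mul hne)
  obtain ⟨ab, hab⟩ := exists_of_coeff_formalSum he0
  obtain ⟨ab', hab'⟩ := exists_of_coeff_formalSum he0'
  have h1 := phiStarTerm_bound hab
  have h2 := phiTerm_bound hab'
  have h3 := congrArg (Finsupp.weight (Sum.elim bosWt bosWt)) (Finset.HasAntidiagonal.mem_antidiagonal.mp hq)
  rw [map_add] at h3
  simp only [Finset.coe_Icc, Set.mem_Icc]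
  omega

theorem hasSubst_plusVar : MvPowerSeries.HasSubst plusVar := by
  let g : BosVar → HirVar := fun v => match v with
    | BosVar.x n => vxbar n
    | BosVar.y n => vybar n
  have hg : Function.Injective g := by
    rintro (m | m) (n | n) h <;> simp_all [g]
  have : Filter.TendstoCofinite g := ⟨hg.tendsto_cofinite⟩
  have : Filter.TendstoCofinite (Sum.inr : BosVar → HirVar) :=
    ⟨Sum.inr_injective.tendsto_cofinite⟩
  have h := (MvPowerSeries.HasSubst.X_comp (R := ℂ) g).add
    (MvPowerSeries.HasSubst.X_comp (R := ℂ) (Sum.inr : BosVar → HirVar))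
  convert h using 1
  funext v
  cases v <;> rfl

theorem hasSubst_minusVar : MvPowerSeries.HasSubst minusVar := by
  let g : BosVar → HirVar := fun v => match v with
    | BosVar.x n => vxbar n
    | BosVar.y n => vybar n
  have hg : Function.Injective g := by
    rintro (m | m) (n | n) h <;> simp_all [g]
  have : Filter.TendstoCofinite g := ⟨hg.tendsto_cofinite⟩
  have : Filter.TendstoCofinite (Sum.inr : BosVar → HirVar) :=
    ⟨Sum.inr_injective.tendsto_cofinite⟩
  have h := (MvPowerSeries.HasSubst.X_comp (R := ℂ) g).add
    ((MvPowerSeries.HasSubst.X_comp (R := ℂ) (Sum.inr : BosVar → HirVar)).smul (-1))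
  convert h using 1
  funext v
  cases v <;> simp [minusVar, g, sub_eq_add_neg]

/-- The grading in which `x_n` and `y_n` have weight `1` and all other variables weight `0`. -/
def shiftWt : HirVar → ℕ
  | Sum.inl (EqVar.x _) => 1
  | Sum.inl (EqVar.y _) => 1
  | _ => 0

theorem locallyFinite_shiftOp (F : CHir) : LocallyFinite fun l : ℕ+ =>
    (MvPowerSeries.X (vx l) * D (vlam l) F + MvPowerSeries.X (vy l) * D (vmu l) F : CHir) := by
  classical
  intro d
  refine ((d.support.finite_toSet.preimage
      (f := vx) (fun a _ b _ h => by simpa using h)).union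
    (d.support.finite_toSet.preimage
      (f := vy) (fun a _ b _ h => by simpa using h))).subset ?_
  intro l h
  by_contra hl
  simp only [Set.mem_union, Set.mem_preimage, Finset.mem_coe, Finsupp.mem_support_iff,
    not_or, not_not] at hl
  apply h
  rw [map_add, MvPowerSeries.X_def, MvPowerSeries.X_def, MvPowerSeries.coeff_monomial_mul,
    MvPowerSeries.coeff_monomial_mul, if_neg, if_neg, add_zero]
  · simp [hl.2]
  · simp [hl.1]

theorem lowWt_shiftOp {r : ℕ} {F : CHir} (hF : LowWt shiftWt r F) :
    LowWt shiftWt (r + 1) (shiftOp F) := by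
  have hD : ∀ v, shiftWt v = 0 → LowWt shiftWt r (D v F) := by
    intro v hv d hd
    have h : MvPowerSeries.coeff (d + Finsupp.single v 1) F * (d v + 1) ≠ 0 := by
      simpa [D, MvPowerSeries.coeff_pderiv] using hd
    have := hF _ (left_ne_zero_of_mul h)
    simpa [Finsupp.weight_single, hv] using this
  intro d hd
  obtain ⟨l, hl⟩ := exists_of_coeff_formalSum hd
  rw [Nat.add_comm]
  exact (((lowWt_X shiftWt (vx l)).mul (hD (vlam l) rfl)).add
    ((lowWt_X shiftWt (vy l)).mul (hD (vmu l) rfl))) d hl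

theorem locallyFinite_expShift (F : CHir) :
    LocallyFinite fun r : ℕ => ((r.factorial : ℂ)⁻¹) • shiftOp^[r] F := by
  have key : ∀ r : ℕ, LowWt shiftWt r (shiftOp^[r] F) := by
    intro r
    induction r with
    | zero => exact fun _ _ => Nat.zero_le _
    | succ r ih =>
      rw [Function.iterate_succ_apply']
      exact lowWt_shiftOp ih
  intro d
  refine (Finset.range (Finsupp.weight shiftWt d + 1)).finite_toSet.subset ?_
  intro r h
  have := ((key r).smul _) d h
  simp only [Finset.coe_range, Set.mem_Iio]
  omega

end BosonicTau

end

noncomputable section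

namespace BosonicTau

open scoped MvPowerSeries.WithPiTopology

/-! ### Topological sums of locally finite families -/

/-! Since `τ` has `p`-degree 0, the only component of `Ω_U(τ ⊗ τ)` with content is the one in `p'
p''⁻¹`, and there `p ∂_p` acts by 0. Expanding both fields turns it into a sum over the mode and
four exponents `(a, b), (c, d)`. The exponent condition in `φ` fixes the mode as `c - d + 1`, so the
Heisenberg index becomes `(a + c) - (b + d)`. It depends only on `i = a + c` and `j = b + d`;
collecting these terms with `S_k(s + t) = ∑ S_p(s) S_{k-p}(t)` (`elemSchur_add`) gives `∑ S_i(x' +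
y' - x'' - y'') α_{i-j} S_j(-(∂x' - ∂y')/n + (∂x'' - ∂y'')/n) τ(x', y') τ(x'', y'') = 0`
(`hasSum_groupedTerm`).

The claim is this identity in the coordinates `x' = x̄ + λ`, `x'' = x̄ - λ`, `y' = ȳ + μ`, `y'' = ȳ
- μ`, with `(λ, μ)` shifted by `(x, y)` and then set to 0. The chain rule gives `∂_λ = ∂x' - ∂x''`
and `∂_x̄ = ∂x' + ∂x''`, so `∂x'` is half their sum. The shift is the exponential of a derivation,
hence an algebra homomorphism (`expShift_mul`), and it commutes with these derivatives
(`D_expShift`). The two sums then agree term by term (`atZero_hirotaTerm`).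

All infinite sums are read as `HasSum` in the product topology on coefficients. Local finiteness,
proved by weight estimates, yields summability; sums may then be regrouped and pushed through
continuous homomorphisms. -/

instance instT3Space_powerSeries {σ : Type*} : T3Space (MvPowerSeries σ ℂ) :=
  inferInstanceAs (T3Space ((σ →₀ ℕ) → ℂ))

theorem LocallyFinite.hasSum {σ ι : Type*} {f : ι → MvPowerSeries σ ℂ} (hf : LocallyFinite f) :
    HasSum f (formalSum f) := by
  rw [MvPowerSeries.WithPiTopology.hasSum_iff_hasSum_coeff]
  intro d
  have h := hf d
  change HasSum _ (∑ᶠ i, MvPowerSeries.coeff d (f i))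
  rw [finsum_eq_sum_of_support_subset (s := h.toFinset) _ (by simp [Function.support])]
  exact hasSum_sum_of_ne_finset_zero fun i hi => by simpa using hi

theorem continuous_of_coeff {σ X : Type*} [TopologicalSpace X] {L : X → MvPowerSeries σ ℂ}
    (h : ∀ e, Continuous fun x => MvPowerSeries.coeff e (L x)) : Continuous L :=
  continuous_pi h

theorem continuous_subst {σ τ : Type*} {a : σ → MvPowerSeries τ ℂ}
    (ha : MvPowerSeries.HasSubst a) :
    Continuous fun F : MvPowerSeries σ ℂ => MvPowerSeries.subst a F := by
  refine continuous_of_coeff fun e => ?_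
  -- Taking the series with all coefficients 1 yields a single finite set of exponents that serves
  -- every `F`.
  have hfin := MvPowerSeries.coeff_subst_finite (R := ℂ) ha (fun _ => (1 : ℂ)) e
  have hs : ∀ F : MvPowerSeries σ ℂ, MvPowerSeries.coeff e (MvPowerSeries.subst a F) =
      ∑ d ∈ Set.Finite.toFinset hfin, MvPowerSeries.coeff d F *
        MvPowerSeries.coeff e (d.prod fun s k => a s ^ k) := by
    intro F
    rw [MvPowerSeries.coeff_subst ha]
    refine finsum_eq_sum_of_support_subset _ fun d hd => ?_
    have h2 := right_ne_zero_of_mul hd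
    exact Set.Finite.mem_toFinset _ |>.mpr (by
      rw [Function.mem_support, show MvPowerSeries.coeff d (fun _ => (1 : ℂ)) = 1 from rfl, one_smul]
      exact h2)
  simp only [hs]
  exact continuous_finsetSum _ fun d _ =>
    (MvPowerSeries.WithPiTopology.continuous_coeff ℂ d).mul continuous_const

theorem continuous_D {σ : Type*} (v : σ) : Continuous (D v : MvPowerSeries σ ℂ → _) := by
  refine continuous_of_coeff fun e => ?_
  simp only [D, Derivation.coeFn_coe, MvPowerSeries.coeff_pderiv]
  exact (MvPowerSeries.WithPiTopology.continuous_coeff ℂ _).mul continuous_const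

theorem continuous_killCompl {σ τ : Type*} (e : σ ↪ τ) :
    Continuous (MvPowerSeries.killCompl e : MvPowerSeries τ ℂ → MvPowerSeries σ ℂ) := by
  refine continuous_of_coeff fun d => ?_
  simp only [MvPowerSeries.coeff_killCompl]
  exact MvPowerSeries.WithPiTopology.continuous_coeff ℂ _

/-- Continuous maps are determined by their values on polynomials. -/
theorem eq_of_eq_on_polynomials {σ X : Type*} [TopologicalSpace X] [T2Space X]
    {L M : MvPowerSeries σ ℂ → X} (hL : Continuous L) (hM : Continuous M)
    (h : ∀ p : MvPolynomial σ ℂ, L p = M p) (F : MvPowerSeries σ ℂ) : L F = M F :=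
  congrFun (MvPowerSeries.WithPiTopology.denseRange_toMvPowerSeries.equalizer hL hM
    (funext h)) F

/-! ### Elementary properties of partial derivatives -/

theorem D_mul {σ : Type*} (v : σ) (F G : MvPowerSeries σ ℂ) :
    D v (F * G) = F * D v G + G * D v F := by
  simp [D]

theorem D_X_self {σ : Type*} (v : σ) : D v (MvPowerSeries.X v : MvPowerSeries σ ℂ) = 1 :=
  MvPowerSeries.pderiv_X_self

theorem D_X_of_ne {σ : Type*} {v w : σ} (h : w ≠ v) :
    D v (MvPowerSeries.X w : MvPowerSeries σ ℂ) = 0 :=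
  MvPowerSeries.pderiv_X_of_ne h

theorem D_comm {σ : Type*} (v w : σ) : Commute (D v) (D w) := by
  classical
  refine LinearMap.ext fun F => ?_
  ext d
  simp only [Module.End.mul_apply, D, Derivation.coeFn_coe, MvPowerSeries.coeff_pderiv,
    Finsupp.add_apply]
  by_cases h : v = w
  · subst h; rfl
  · rw [Finsupp.single_eq_of_ne h, Finsupp.single_eq_of_ne (Ne.symm h), add_right_comm]
    push_cast
    ring

/-- The chain rule for substitutions with constant partial derivatives: it suffices to know
the derivative on the variables. -/
theorem D_subst {σ τ : Type*} {a : σ → MvPowerSeries τ ℂ} (ha : MvPowerSeries.HasSubst a) (w : τ)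
    (E : Module.End ℂ (MvPowerSeries σ ℂ)) (hE : Continuous E)
    (hmul : ∀ F G, E (F * G) = F * E G + G * E F)
    (hX : ∀ v, D w (a v) = MvPowerSeries.subst a (E (MvPowerSeries.X v)))
    (F : MvPowerSeries σ ℂ) :
    D w (MvPowerSeries.subst a F) = MvPowerSeries.subst a (E F) := by
  refine eq_of_eq_on_polynomials ((continuous_D w).comp (continuous_subst ha))
    ((continuous_subst ha).comp hE) (fun p => ?_) F
  have h1 : E 1 = 0 := by simpa using hmul 1 1
  simp only [Function.comp_apply]
  induction p using MvPolynomial.induction_on with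
  | C c =>
    have h2 : ((MvPolynomial.C c : MvPolynomial σ ℂ) : MvPowerSeries σ ℂ) = c • 1 := by
      rw [MvPolynomial.coe_C, MvPowerSeries.smul_eq_C_mul, mul_one]
    have h3 : D w (1 : MvPowerSeries τ ℂ) = 0 := by simpa using D_mul w (1 : MvPowerSeries τ ℂ) 1
    rw [h2, map_smul, h1, ← MvPowerSeries.coe_substAlgHom ha, map_smul, map_one, map_smul, h3, smul_zero,
      smul_zero, map_zero]
  | add p q hp hq =>
    rw [MvPolynomial.coe_add, MvPowerSeries.subst_add ha, map_add, map_add,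
      MvPowerSeries.subst_add ha, hp, hq]
  | mul_X p v hp =>
    rw [MvPolynomial.coe_mul, MvPolynomial.coe_X, MvPowerSeries.subst_mul ha, D_mul, hmul,
      MvPowerSeries.subst_add ha, MvPowerSeries.subst_mul ha, MvPowerSeries.subst_mul ha, hp,
      MvPowerSeries.subst_X ha, hX]

/-! ### Elementary Schur polynomials -/

theorem coeff_genSeries_pow_of_lt {A : Type*} [Ring A] (t : ℕ+ → A) (r : ℕ) :
    ∀ k < r, PowerSeries.coeff k (genSeries t ^ r) = 0 := by
  induction r with
  | zero => intro k hk; omega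
  | succ r ih =>
    intro k hk
    rw [pow_succ, PowerSeries.coeff_mul]
    refine Finset.sum_eq_zero fun p hp => ?_
    have hp' := Finset.HasAntidiagonal.mem_antidiagonal.mp hp
    by_cases h : p.1 < r
    · rw [ih _ h, zero_mul]
    · have : p.2 = 0 := by omega
      simp [this, genSeries, extZ]

/-- The series has no constant term, so its `r`-th power starts at `z ^ r` and the cutoff may be
raised freely. This allows a common cutoff for Schur polynomials of different degrees. -/
theorem elemSchur_eq_sum {A : Type*} [Ring A] [Algebra ℂ A] (t : ℕ+ → A) {k N : ℕ} (h : k ≤ N) :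
    elemSchur t k =
      ∑ r ∈ Finset.range (N + 1), ((r.factorial : ℂ)⁻¹) • PowerSeries.coeff k (genSeries t ^ r) := by
  refine Finset.sum_subset (Finset.range_mono (by omega)) fun r _ hr => ?_
  rw [coeff_genSeries_pow_of_lt t r k (by simpa using hr), smul_zero]

theorem genSeries_add {A : Type*} [Ring A] (s t : ℕ+ → A) :
    genSeries (s + t) = genSeries s + genSeries t := by
  ext n
  simp only [genSeries, PowerSeries.coeff_mk, map_add, extZ]
  split_ifs <;> simp

theorem commute_genSeries {A : Type*} [Ring A] {s t : ℕ+ → A} (h : ∀ m n, Commute (s m) (t n)) :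
    Commute (genSeries s) (genSeries t) := by
  ext n
  have hc : ∀ i j : ℕ, Commute (extZ s i) (extZ t j) := by
    intro i j
    unfold extZ
    split_ifs
    · exact h _ _
    all_goals simp
  simp only [PowerSeries.coeff_mul, genSeries, PowerSeries.coeff_mk]
  rw [← Finset.Nat.sum_antidiagonal_swap]
  exact Finset.sum_congr rfl fun p _ => hc _ _

/-- This is `exp (s + t) = exp s * exp t` for commuting series. The binomial theorem gives a sum
over the triangle `r₁ + r₂ ≤ k`, the product of exponentials a sum over the square `r₁, r₂ ≤ k`; the
terms in between vanish because they start beyond `z ^ k`. -/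
theorem elemSchur_add {A : Type*} [Ring A] [Algebra ℂ A] {s t : ℕ+ → A}
    (h : ∀ m n, Commute (s m) (t n)) (k : ℕ) :
    elemSchur (s + t) k =
      ∑ p ∈ Finset.HasAntidiagonal.antidiagonal k, elemSchur s p.1 * elemSchur t p.2 := by
  set S := genSeries s
  set T := genSeries t
  let g : ℕ × ℕ → A := fun r => ((r.1.factorial : ℂ)⁻¹ * (r.2.factorial : ℂ)⁻¹) •
    PowerSeries.coeff k (S ^ r.1 * T ^ r.2)
  have hlt : ∀ r : ℕ × ℕ, k < r.1 + r.2 → g r = 0 := by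
    intro r hr
    simp only [g]
    rw [PowerSeries.coeff_mul, Finset.sum_eq_zero, smul_zero]
    intro p hp
    have hp' := Finset.HasAntidiagonal.mem_antidiagonal.mp hp
    by_cases h1 : p.1 < r.1
    · rw [coeff_genSeries_pow_of_lt s _ _ h1, zero_mul]
    · rw [coeff_genSeries_pow_of_lt t _ _ (by omega), mul_zero]
  have hL : elemSchur (s + t) k = ∑ r ∈ Finset.range (k + 1), ∑ q ∈ Finset.HasAntidiagonal.antidiagonal r, g q := by
    refine Finset.sum_congr rfl fun r _ => ?_
    rw [genSeries_add, (commute_genSeries h).add_pow', map_sum, Finset.smul_sum]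
    refine Finset.sum_congr rfl fun q hq => ?_
    have hq' := Finset.HasAntidiagonal.mem_antidiagonal.mp hq
    rw [map_nsmul, ← Nat.cast_smul_eq_nsmul ℂ, smul_smul]
    congr 1
    have h1 := Nat.choose_mul_factorial_mul_factorial (show q.1 ≤ r by omega)
    rw [show r - q.1 = q.2 by omega] at h1
    have h2 : ((r.choose q.1 : ℂ) * q.1.factorial) * q.2.factorial = r.factorial := by
      exact_mod_cast h1
    have := Nat.factorial_ne_zero
    have n1 : (r.factorial : ℂ) ≠ 0 := by exact_mod_cast this r
    have n2 : (q.1.factorial : ℂ) ≠ 0 := by exact_mod_cast this q.1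
    have n3 : (q.2.factorial : ℂ) ≠ 0 := by exact_mod_cast this q.2
    field_simp
    linear_combination h2
  have hR : ∑ p ∈ Finset.HasAntidiagonal.antidiagonal k, elemSchur s p.1 * elemSchur t p.2 =
      ∑ q ∈ Finset.range (k + 1) ×ˢ Finset.range (k + 1), g q := by
    simp only [g, PowerSeries.coeff_mul, Finset.smul_sum]
    rw [Finset.sum_comm]
    refine Finset.sum_congr rfl fun p hp => ?_
    have hp' := Finset.HasAntidiagonal.mem_antidiagonal.mp hp
    rw [elemSchur_eq_sum s (show p.1 ≤ k by omega), elemSchur_eq_sum t (show p.2 ≤ k by omega),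
      Finset.sum_mul_sum, Finset.sum_product]
    refine Finset.sum_congr rfl fun i _ => Finset.sum_congr rfl fun j _ => ?_
    rw [smul_mul_smul_comm]
  rw [hL, hR, Finset.sum_sigma']
  refine Finset.sum_bij_ne_zero (fun x _ _ => x.2) ?_ ?_ ?_ ?_
  · rintro ⟨r, q⟩ hx _
    simp only [Finset.mem_sigma, Finset.mem_range, Finset.HasAntidiagonal.mem_antidiagonal] at hx
    simp only [Finset.mem_product, Finset.mem_range]
    omega
  · rintro ⟨r, q⟩ hx _ ⟨r', q'⟩ hx' _ he
    simp only [Finset.mem_sigma, Finset.mem_range, Finset.HasAntidiagonal.mem_antidiagonal] at hx hx' he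
    subst he
    obtain rfl : r = r' := by omega
    rfl
  · intro q _ hg
    have : ¬ k < q.1 + q.2 := fun h => hg (hlt q h)
    exact ⟨⟨q.1 + q.2, q⟩, by simp; omega, hg, rfl⟩
  · intros; rfl

theorem map_elemSchur {A B : Type*} [Ring A] [Algebra ℂ A] [Ring B] [Algebra ℂ B] (f : A →ₐ[ℂ] B)
    (t : ℕ+ → A) (k : ℕ) : f (elemSchur t k) = elemSchur (fun n => f (t n)) k := by
  have h : genSeries (fun n => f (t n)) = PowerSeries.map (f : A →+* B) (genSeries t) := by
    ext n
    simp only [genSeries, PowerSeries.coeff_mk, PowerSeries.coeff_map, extZ]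
    split_ifs <;> simp
  simp only [elemSchur, map_sum, map_smul, h, ← map_pow, PowerSeries.coeff_map, RingHom.coe_coe]

/-- A linear map intertwining two families of operators intertwines their Schur polynomials. -/
theorem elemSchur_intertwine {V W : Type*} [AddCommGroup V] [Module ℂ V] [AddCommGroup W]
    [Module ℂ W] (L : V →ₗ[ℂ] W) {s : ℕ+ → Module.End ℂ V} {t : ℕ+ → Module.End ℂ W}
    (h : ∀ n v, L (s n v) = t n (L v)) (k : ℕ) (v : V) :
    L (elemSchur s k v) = elemSchur t k (L v) := by
  have hext : ∀ (n : ℤ) (v : V), L (extZ s n v) = extZ t n (L v) := by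
    intro n v
    unfold extZ
    split_ifs
    · exact h _ _
    · simp
  have key : ∀ (r k : ℕ) (v : V), L ((PowerSeries.coeff k (genSeries s ^ r) : Module.End ℂ V) v) =
      (PowerSeries.coeff k (genSeries t ^ r) : Module.End ℂ W) (L v) := by
    intro r
    induction r with
    | zero =>
      intro k v
      by_cases hk : k = 0 <;> simp [PowerSeries.coeff_one, hk]
    | succ r ih =>
      intro k v
      have hg : ∀ (n : ℕ) (v : V), L ((PowerSeries.coeff n (genSeries s) : Module.End ℂ V) v) =
          (PowerSeries.coeff n (genSeries t) : Module.End ℂ W) (L v) := by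
        simpa only [genSeries, PowerSeries.coeff_mk] using fun n : ℕ => hext n
      simp only [pow_succ, PowerSeries.coeff_mul, LinearMap.sum_apply, map_sum,
        Module.End.mul_apply, ih, hg]
  simp only [elemSchur, LinearMap.sum_apply, map_sum, LinearMap.smul_apply, map_smul, key]

/-! ### The operator `exp (∑ (x_l ∂/∂λ_l + y_l ∂/∂μ_l))` -/

/-- The finite set in `hs` is uniform in `x`, so each coefficient is a fixed finite sum of
continuous functions; local finiteness at each `x` separately would not suffice. -/
theorem continuous_formalSum {σ ι X : Type*} [TopologicalSpace X] {f : X → ι → MvPowerSeries σ ℂ}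
    (hf : ∀ i, Continuous fun x => f x i)
    (hs : ∀ d : σ →₀ ℕ, ∃ s : Finset ι, ∀ x, ∀ i ∉ s, MvPowerSeries.coeff d (f x i) = 0) :
    Continuous fun x => formalSum (f x) := by
  refine continuous_of_coeff fun d => ?_
  obtain ⟨s, hs⟩ := hs d
  have h : ∀ x, MvPowerSeries.coeff d (formalSum (f x)) =
      ∑ i ∈ s, MvPowerSeries.coeff d (f x i) := fun x =>
    finsum_eq_sum_of_support_subset _ fun i hi => by
      by_contra h
      exact hi (hs x i h)
  simp only [h]
  exact continuous_finsetSum _ fun i _ =>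
    (MvPowerSeries.WithPiTopology.continuous_coeff ℂ d).comp (hf i)

theorem hasSum_shiftOp (F : CHir) : HasSum (fun l : ℕ+ =>
    MvPowerSeries.X (vx l) * D (vlam l) F + MvPowerSeries.X (vy l) * D (vmu l) F) (shiftOp F) :=
  (locallyFinite_shiftOp F).hasSum

/-- `shiftOp` as a linear operator. -/
def shiftLin : Module.End ℂ CHir where
  toFun := shiftOp
  map_add' F G := by
    refine (hasSum_shiftOp _).unique (((hasSum_shiftOp F).add (hasSum_shiftOp G)).congr_fun ?_)
    intro l
    simp only [map_add]
    ring
  map_smul' c F := by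
    refine (hasSum_shiftOp _).unique (((hasSum_shiftOp F).const_smul c).congr_fun ?_)
    intro l
    simp only [map_smul, smul_add, mul_smul_comm]

theorem shiftLin_apply (F : CHir) : shiftLin F = shiftOp F := rfl

theorem shiftLin_pow_apply (r : ℕ) (F : CHir) : (shiftLin ^ r) F = shiftOp^[r] F := by
  rw [Module.End.pow_apply]; rfl

theorem shiftLin_mul (F G : CHir) : shiftLin (F * G) = F * shiftLin G + G * shiftLin F := by
  refine (hasSum_shiftOp _).unique
    ((((hasSum_shiftOp G).mul_left F).add ((hasSum_shiftOp F).mul_left G)).congr_fun ?_)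
  intro l
  simp only [D_mul]
  ring

theorem continuous_shiftOp : Continuous shiftOp := by
  refine continuous_formalSum (fun l => ?_) fun d => ?_
  · exact (continuous_const.mul (continuous_D _)).add (continuous_const.mul (continuous_D _))
  · have hfin := (d.support.finite_toSet.preimage
      (f := vx) (fun a _ b _ h => by simpa using h)).union
      (d.support.finite_toSet.preimage (f := vy) (fun a _ b _ h => by simpa using h))
    refine ⟨hfin.toFinset, fun F l hl => ?_⟩
    simp only [Set.Finite.mem_toFinset, Set.mem_union, Set.mem_preimage, Finset.mem_coe,
      Finsupp.mem_support_iff, not_or, not_not] at hl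
    classical
    rw [map_add, MvPowerSeries.X_def, MvPowerSeries.X_def, MvPowerSeries.coeff_monomial_mul,
      MvPowerSeries.coeff_monomial_mul, if_neg, if_neg, add_zero]
    · simp [hl.2]
    · simp [hl.1]

theorem lowWt_shiftOp_iterate (F : CHir) (r : ℕ) : LowWt shiftWt r (shiftOp^[r] F) := by
  induction r with
  | zero => exact fun _ _ => Nat.zero_le _
  | succ r ih =>
    rw [Function.iterate_succ_apply']
    exact lowWt_shiftOp ih

theorem hasSum_expShift (F : CHir) :
    HasSum (fun r : ℕ => ((r.factorial : ℂ)⁻¹) • (shiftLin ^ r) F) (expShift F) := by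
  simp only [shiftLin_pow_apply]
  exact (locallyFinite_expShift F).hasSum

theorem continuous_expShift : Continuous expShift := by
  refine continuous_formalSum (fun r => ?_) fun d => ?_
  · exact Continuous.const_smul (continuous_shiftOp.iterate r) ((r.factorial : ℂ)⁻¹)
  · refine ⟨Finset.range (Finsupp.weight shiftWt d + 1), fun F r hr => ?_⟩
    by_contra h
    have := ((lowWt_shiftOp_iterate F r).smul _) d h
    rw [Finset.mem_range] at hr
    omega

/-- The Leibniz rule for the divided powers of a derivation. -/
theorem dividedPow_leibniz {A : Type*} [CommRing A] [Algebra ℂ A] (S : Module.End ℂ A)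
    (hS : ∀ F G, S (F * G) = F * S G + G * S F) (r : ℕ) (F G : A) :
    ((r.factorial : ℂ)⁻¹) • (S ^ r) (F * G) = ∑ p ∈ Finset.HasAntidiagonal.antidiagonal r,
      (((p.1.factorial : ℂ)⁻¹) • (S ^ p.1) F) * (((p.2.factorial : ℂ)⁻¹) • (S ^ p.2) G) := by
  have hstep : ∀ (n : ℕ) (H : A), S (((n.factorial : ℂ)⁻¹) • (S ^ n) H) =
      ((n + 1 : ℕ) : ℂ) • (((n + 1).factorial : ℂ)⁻¹ • (S ^ (n + 1)) H) := by
    intro n H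
    rw [map_smul, smul_smul, pow_succ', Module.End.mul_apply, Nat.factorial_succ]
    congr 1
    have h1 : (n.factorial : ℂ) ≠ 0 := by exact_mod_cast n.factorial_ne_zero
    have h2 : ((n + 1 : ℕ) : ℂ) ≠ 0 := by exact_mod_cast n.succ_ne_zero
    push_cast at h2 ⊢
    field_simp
  set E : ℕ → A → A := fun n H => ((n.factorial : ℂ)⁻¹) • (S ^ n) H with hE
  change E r (F * G) = ∑ p ∈ Finset.HasAntidiagonal.antidiagonal r, E p.1 F * E p.2 G
  induction r with
  | zero => simp [hE]
  | succ r ih =>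
    have hne : ((r + 1 : ℕ) : ℂ) ≠ 0 := by exact_mod_cast r.succ_ne_zero
    -- With `E n = S ^ n / n!` one has `S ∘ E n = (n + 1) E (n + 1)`. After multiplication by `r + 1
    -- = p.1 + p.2` the right side splits into the two halves produced by the product rule for `S`.
    refine smul_right_injective A hne ?_
    change ((r + 1 : ℕ) : ℂ) • E (r + 1) (F * G) = ((r + 1 : ℕ) : ℂ) • _
    have h1 : ((r + 1 : ℕ) : ℂ) • ∑ p ∈ Finset.HasAntidiagonal.antidiagonal (r + 1),
        E p.1 F * E p.2 G =
        ∑ p ∈ Finset.HasAntidiagonal.antidiagonal (r + 1), (p.1 : ℂ) • (E p.1 F * E p.2 G) +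
        ∑ p ∈ Finset.HasAntidiagonal.antidiagonal (r + 1), (p.2 : ℂ) • (E p.1 F * E p.2 G) := by
      rw [Finset.smul_sum, ← Finset.sum_add_distrib]
      refine Finset.sum_congr rfl fun p hp => ?_
      rw [← add_smul, ← Nat.cast_add, Finset.HasAntidiagonal.mem_antidiagonal.mp hp]
    rw [h1, Finset.Nat.sum_antidiagonal_succ, Finset.Nat.sum_antidiagonal_succ', ← hstep r]
    change S (E r (F * G)) = _
    rw [ih, map_sum]
    simp only [hS, Finset.sum_add_distrib, Nat.cast_zero, zero_smul, zero_add]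
    rw [add_comm]
    congr 1
    · refine Finset.sum_congr rfl fun p _ => ?_
      rw [hstep p.1, mul_smul_comm, mul_comm]
    · refine Finset.sum_congr rfl fun p _ => ?_
      rw [hstep p.2, mul_smul_comm]

/-- By the Leibniz rule for divided powers, the exponential of a derivation of a product is the
Cauchy product of the exponentials. The double family is summable because its `(p, q)` member has
degree at least `p + q` in `x, y`. -/
theorem expShift_mul (F G : CHir) : expShift (F * G) = expShift F * expShift G := by
  have hloc : LocallyFinite fun p : ℕ × ℕ => (((p.1.factorial : ℂ)⁻¹) • (shiftLin ^ p.1) F) *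
      (((p.2.factorial : ℂ)⁻¹) • (shiftLin ^ p.2) G) := by
    intro d
    refine (Finset.range (Finsupp.weight shiftWt d + 1) ×ˢ
      Finset.range (Finsupp.weight shiftWt d + 1)).finite_toSet.subset fun p hp => ?_
    simp only [shiftLin_pow_apply] at hp
    have := (((lowWt_shiftOp_iterate F p.1).smul _).mul ((lowWt_shiftOp_iterate G p.2).smul _)) d hp
    simp only [Finset.coe_product, Set.mem_prod, Finset.mem_coe, Finset.mem_range]
    omega
  have h := (hasSum_expShift F).summable.tsum_mul_tsum_eq_tsum_sum_antidiagonal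
    (hasSum_expShift G).summable hloc.hasSum.summable
  rw [(hasSum_expShift F).tsum_eq, (hasSum_expShift G).tsum_eq] at h
  rw [h, ← (hasSum_expShift (F * G)).tsum_eq]
  exact tsum_congr fun r => dividedPow_leibniz shiftLin shiftLin_mul r F G

/-- The exponential series stops after its linear term. This covers `λ_n` and `μ_n`, whose images
`x_n` and `y_n` are killed by the shift. -/
theorem expShift_of_shiftOp_shiftOp {F : CHir} (h : shiftOp (shiftOp F) = 0) :
    expShift F = F + shiftOp F := by
  refine (hasSum_expShift F).unique ?_
  have h2 := hasSum_sum_of_ne_finset_zero (L := .unconditional ℕ) (s := Finset.range 2)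
    (f := fun r : ℕ => ((r.factorial : ℂ)⁻¹) • (shiftLin ^ r) F) fun r hr => by
      obtain ⟨k, rfl⟩ : ∃ k, r = k + 2 := ⟨r - 2, by simp at hr; omega⟩
      have : (shiftLin ^ 2) F = 0 := by rw [shiftLin_pow_apply]; exact h
      simp [pow_add, this]
  simpa [Finset.sum_range_succ, shiftLin_apply] using h2

theorem shiftOp_zero : shiftOp 0 = 0 := map_zero shiftLin

theorem expShift_of_shiftOp {F : CHir} (h : shiftOp F = 0) : expShift F = F := by
  rw [expShift_of_shiftOp_shiftOp (by rw [h, shiftOp_zero]), h, add_zero]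

theorem shiftOp_X_of_ne {v : HirVar} (h1 : ∀ n, v ≠ vlam n) (h2 : ∀ n, v ≠ vmu n) :
    shiftOp (MvPowerSeries.X v) = 0 := by
  refine (hasSum_shiftOp _).unique ?_
  simp only [D_X_of_ne (h1 _), D_X_of_ne (h2 _), mul_zero, add_zero]
  exact hasSum_zero

theorem shiftOp_X_vlam (n : ℕ+) : shiftOp (MvPowerSeries.X (vlam n)) = MvPowerSeries.X (vx n) := by
  refine (hasSum_shiftOp _).unique ?_
  have h := hasSum_single (f := fun l : ℕ+ =>
    (MvPowerSeries.X (vx l) * D (vlam l) (MvPowerSeries.X (vlam n))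
      + MvPowerSeries.X (vy l) * D (vmu l) (MvPowerSeries.X (vlam n)) : CHir)) n fun l hl => by
      rw [D_X_of_ne (by simpa using hl.symm), D_X_of_ne (by simp)]
      simp
  simpa [D_X_self, D_X_of_ne] using h

theorem shiftOp_X_vmu (n : ℕ+) : shiftOp (MvPowerSeries.X (vmu n)) = MvPowerSeries.X (vy n) := by
  refine (hasSum_shiftOp _).unique ?_
  have h := hasSum_single (f := fun l : ℕ+ =>
    (MvPowerSeries.X (vx l) * D (vlam l) (MvPowerSeries.X (vmu n))
      + MvPowerSeries.X (vy l) * D (vmu l) (MvPowerSeries.X (vmu n)) : CHir)) n fun l hl => by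
      rw [D_X_of_ne (by simp), D_X_of_ne (by simpa using hl.symm)]
      simp
  simpa [D_X_self, D_X_of_ne] using h

/-- `expShift` as an algebra endomorphism. -/
def expShiftHom : CHir →ₐ[ℂ] CHir :=
  AlgHom.ofLinearMap
    { toFun := expShift
      map_add' := fun F G => (hasSum_expShift _).unique
        (((hasSum_expShift F).add (hasSum_expShift G)).congr_fun fun r => by
          simp only [map_add, smul_add])
      map_smul' := fun c F => (hasSum_expShift _).unique
        (((hasSum_expShift F).const_smul c).congr_fun fun r => by
          simp only [map_smul, smul_comm c]) }
    (expShift_of_shiftOp (show shiftLin 1 = 0 by simpa using shiftLin_mul 1 1))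
    expShift_mul

theorem expShiftHom_apply (F : CHir) : expShiftHom F = expShift F := rfl

/-- The coefficients `x_l, y_l` of the shift are constants for `∂_v` once `v` is none of them, so
`∂_v` commutes with every power of the shift. -/
theorem D_expShift {v : HirVar} (h1 : ∀ n, vx n ≠ v) (h2 : ∀ n, vy n ≠ v) (F : CHir) :
    D v (expShift F) = expShift (D v F) := by
  have hc : ∀ F, D v (shiftLin F) = shiftLin (D v F) := by
    intro F
    refine (((hasSum_shiftOp F).map (D v) (continuous_D v)).unique
      ((hasSum_shiftOp (D v F)).congr_fun fun l => ?_))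
    have e1 := LinearMap.congr_fun (D_comm v (vlam l)) F
    have e2 := LinearMap.congr_fun (D_comm v (vmu l)) F
    simp only [Module.End.mul_apply] at e1 e2
    simp only [Function.comp_apply, map_add, D_mul, D_X_of_ne (h1 l), D_X_of_ne (h2 l), e1, e2]
    ring
  have hp : ∀ r : ℕ, D v ((shiftLin ^ r) F) = (shiftLin ^ r) (D v F) := by
    intro r
    induction r with
    | zero => rfl
    | succ r ih => rw [pow_succ', Module.End.mul_apply, Module.End.mul_apply, hc, ih]
  refine (((hasSum_expShift F).map (D v) (continuous_D v)).unique
    ((hasSum_expShift (D v F)).congr_fun fun r => ?_))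
  simp only [Function.comp_apply, map_smul, hp]

/-! ### The Hirota equation as a sum over pairs -/

instance tendstoCofinite_inl : Filter.TendstoCofinite (Sum.inl : BosVar → BosVar ⊕ BosVar) :=
  ⟨Sum.inl_injective.tendsto_cofinite⟩

instance tendstoCofinite_inr : Filter.TendstoCofinite (Sum.inr : BosVar → BosVar ⊕ BosVar) :=
  ⟨Sum.inr_injective.tendsto_cofinite⟩

/-- The algebra `ℂ[[x', y', x'', y'']]`. -/
abbrev CTwo : Type := MvPowerSeries (BosVar ⊕ BosVar) ℂ

theorem hasSubst_inl : MvPowerSeries.HasSubst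
    (fun v : BosVar => (MvPowerSeries.X (Sum.inl v) : CTwo)) :=
  MvPowerSeries.HasSubst.X_comp (R := ℂ) (Sum.inl : BosVar → BosVar ⊕ BosVar)

theorem hasSubst_inr : MvPowerSeries.HasSubst
    (fun v : BosVar => (MvPowerSeries.X (Sum.inr v) : CTwo)) :=
  MvPowerSeries.HasSubst.X_comp (R := ℂ) (Sum.inr : BosVar → BosVar ⊕ BosVar)

/-- `f(x, y) ↦ f(x', y')`. -/
def inLeft : CXY →ₐ[ℂ] CTwo := MvPowerSeries.substAlgHom hasSubst_inl

/-- `f(x, y) ↦ f(x'', y'')`. -/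
def inRight : CXY →ₐ[ℂ] CTwo := MvPowerSeries.substAlgHom hasSubst_inr

theorem inLeft_apply (f : CXY) :
    inLeft f = MvPowerSeries.subst (fun v => MvPowerSeries.X (Sum.inl v)) f :=
  MvPowerSeries.substAlgHom_apply hasSubst_inl f

theorem inRight_apply (f : CXY) :
    inRight f = MvPowerSeries.subst (fun v => MvPowerSeries.X (Sum.inr v)) f :=
  MvPowerSeries.substAlgHom_apply hasSubst_inr f

theorem continuous_inLeft : Continuous inLeft :=
  (continuous_subst hasSubst_inl).congr fun f => (inLeft_apply f).symm

theorem continuous_inRight : Continuous inRight :=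
  (continuous_subst hasSubst_inr).congr fun f => (inRight_apply f).symm

theorem inLeft_X (v : BosVar) : inLeft (MvPowerSeries.X v) = MvPowerSeries.X (Sum.inl v) :=
  MvPowerSeries.substAlgHom_X hasSubst_inl v

theorem inRight_X (v : BosVar) : inRight (MvPowerSeries.X v) = MvPowerSeries.X (Sum.inr v) :=
  MvPowerSeries.substAlgHom_X hasSubst_inr v

theorem D_inl_inLeft (v : BosVar) (f : CXY) : D (Sum.inl v) (inLeft f) = inLeft (D v f) := by
  rw [inLeft_apply, inLeft_apply]
  refine D_subst hasSubst_inl _ (D v) (continuous_D v) (D_mul v) (fun w => ?_) f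
  rw [← inLeft_apply]
  by_cases h : w = v
  · rw [h, D_X_self, D_X_self, map_one]
  · rw [D_X_of_ne h, D_X_of_ne (by simpa using h), map_zero]

theorem D_inr_inRight (v : BosVar) (f : CXY) : D (Sum.inr v) (inRight f) = inRight (D v f) := by
  rw [inRight_apply, inRight_apply]
  refine D_subst hasSubst_inr _ (D v) (continuous_D v) (D_mul v) (fun w => ?_) f
  rw [← inRight_apply]
  by_cases h : w = v
  · rw [h, D_X_self, D_X_self, map_one]
  · rw [D_X_of_ne h, D_X_of_ne (by simpa using h), map_zero]

theorem D_inl_inRight (v : BosVar) (f : CXY) : D (Sum.inl v) (inRight f) = 0 := by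
  -- The zero operator is a derivation, and it is the right one on variables: no double-primed
  -- variable depends on a single-primed one.
  rw [inRight_apply, D_subst hasSubst_inr _ 0 continuous_zero (by simp) (fun w => ?_) f]
  · rw [← inRight_apply, LinearMap.zero_apply, map_zero]
  · rw [← inRight_apply, LinearMap.zero_apply, map_zero, D_X_of_ne (by simp)]

theorem D_inr_inLeft (v : BosVar) (f : CXY) : D (Sum.inr v) (inLeft f) = 0 := by
  rw [inLeft_apply, D_subst hasSubst_inl _ 0 continuous_zero (by simp) (fun w => ?_) f]
  · rw [← inLeft_apply, LinearMap.zero_apply, map_zero]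
  · rw [← inLeft_apply, LinearMap.zero_apply, map_zero, D_X_of_ne (by simp)]

/-- The Heisenberg mode `α_n` acting on the first factor, in degree `0` with respect to `p'`. -/
def alphaTwo (n : ℤ) : Module.End ℂ CTwo :=
  extZ (fun k => D (Sum.inl (BosVar.x k))) n + LinearMap.mulLeft ℂ
    (extZ (fun k => ((k : ℕ) : ℂ) • (MvPowerSeries.X (Sum.inl (BosVar.x k)) : CTwo)) (-n))

theorem alphaTwo_mul_inRight (n : ℤ) (F : CTwo) (g : CXY) :
    alphaTwo n (F * inRight g) = alphaTwo n F * inRight g := by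
  simp only [alphaTwo, LinearMap.add_apply, LinearMap.mulLeft_apply, add_mul, mul_assoc]
  congr 1
  unfold extZ
  split_ifs
  · rw [D_mul, D_inl_inRight, mul_zero, zero_add, mul_comm]
  · simp

theorem inLeft_alphaMode (n : ℤ) (f : CXY) : inLeft (alphaMode 0 n f) = alphaTwo n (inLeft f) := by
  simp only [alphaMode, Int.cast_zero, zero_smul, ite_self, add_zero, map_add, map_mul, alphaTwo,
    LinearMap.add_apply, LinearMap.mulLeft_apply]
  congr 1
  · unfold extZ
    split_ifs
    · rw [D_inl_inLeft]
    · simp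
  · congr 1
    unfold extZ
    split_ifs
    · rw [map_smul, inLeft_X]
    · simp

/-- `x'_n + y'_n`. -/
def leftXY (n : ℕ+) : CTwo :=
  MvPowerSeries.X (Sum.inl (BosVar.x n)) + MvPowerSeries.X (Sum.inl (BosVar.y n))

/-- `-(x''_n + y''_n)`. -/
def rightXY (n : ℕ+) : CTwo :=
  -(MvPowerSeries.X (Sum.inr (BosVar.x n)) + MvPowerSeries.X (Sum.inr (BosVar.y n)))

/-- `-(∂/∂x'_n - ∂/∂y'_n) / n`. -/
def leftD (n : ℕ+) : Module.End ℂ CTwo :=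
  -((((n : ℕ) : ℂ)⁻¹) • (D (Sum.inl (BosVar.x n)) - D (Sum.inl (BosVar.y n))))

/-- `(∂/∂x''_n - ∂/∂y''_n) / n`. -/
def rightD (n : ℕ+) : Module.End ℂ CTwo :=
  (((n : ℕ) : ℂ)⁻¹) • (D (Sum.inr (BosVar.x n)) - D (Sum.inr (BosVar.y n)))

theorem commute_leftD_rightD (m n : ℕ+) : Commute (leftD m) (rightD n) := by
  unfold leftD rightD
  have h (u v w z : BosVar ⊕ BosVar) : Commute (D u - D v) (D w - D z) :=
    ((D_comm u w).sub_right (D_comm u z)).sub_left ((D_comm v w).sub_right (D_comm v z))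
  exact (((h _ _ _ _).smul_left _).smul_right _).neg_left

theorem inLeft_elemSchur (k : ℕ) : inLeft (elemSchur xPlusY k) = elemSchur leftXY k := by
  rw [map_elemSchur]
  congr 1
  funext n
  simp [xPlusY, leftXY, inLeft_X]

theorem inRight_elemSchur (k : ℕ) : inRight (elemSchur (-xPlusY) k) = elemSchur rightXY k := by
  rw [map_elemSchur]
  congr 1
  funext n
  simp [xPlusY, rightXY, inRight_X]

/-- A function of the double-primed variables is a constant for the single-primed derivatives, so `f
↦ f(x', y') g(x'', y'')` intertwines the two families of operators. -/
theorem inLeft_elemSchur_mul (k : ℕ) (f : CXY) (g : CXY) :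
    inLeft (elemSchur (-dxMinusDy) k f) * inRight g =
      elemSchur leftD k (inLeft f * inRight g) := by
  refine elemSchur_intertwine ((LinearMap.mulRight ℂ (inRight g)).comp inLeft.toLinearMap)
    (fun n v => ?_) k f
  simp [dxMinusDy, leftD, D_mul, ← D_inl_inLeft, D_inl_inRight, mul_comm]
  ring_nf

theorem mul_inRight_elemSchur (k : ℕ) (f : CXY) (g : CXY) :
    inLeft f * inRight (elemSchur dxMinusDy k g) =
      elemSchur rightD k (inLeft f * inRight g) := by
  refine elemSchur_intertwine ((LinearMap.mulLeft ℂ (inLeft f)).comp inRight.toLinearMap)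
    (fun n v => ?_) k g
  simp [dxMinusDy, rightD, D_mul, ← D_inr_inRight, D_inr_inLeft, mul_sub]

/-- `τ(x', y') τ(x'', y'')`. -/
def tauTwo (τ : CXY) : CTwo := inLeft τ * inRight τ

/-- The summands of the Hirota equation before grouping. -/
def quadTerm (τ : CXY) (pq : (ℕ × ℕ) × (ℕ × ℕ)) : CTwo :=
  elemSchur leftXY pq.1.1 * elemSchur rightXY pq.2.1 *
    alphaTwo ((pq.1.1 + pq.2.1 : ℕ) - (pq.1.2 + pq.2.2 : ℕ))
      (elemSchur leftD pq.1.2 (elemSchur rightD pq.2.2 (tauTwo τ)))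

/-- The summands of the Hirota equation indexed by the mode and the four exponents. -/
def modeTerm (τ : CXY) (x : Σ _ : ℤ, (ℕ × ℕ) × (ℕ × ℕ)) : CTwo :=
  inLeft (phiStarTerm x.1 (ofCXY τ) 1 x.2.1) * inRight (phiTerm (-x.1) (ofCXY τ) (-1) x.2.2)

theorem modeTerm_of_ne {τ : CXY} {x : Σ _ : ℤ, (ℕ × ℕ) × (ℕ × ℕ)}
    (h : (x.2.2.2 : ℤ) ≠ x.2.2.1 + -x.1 + 1) : modeTerm τ x = 0 := by
  rw [modeTerm, phiTerm, if_neg h, map_zero, mul_zero]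

/-- The mode `c - d + 1` is the one selected by the condition in `phiTerm`; it turns `a - b + m - 1`
into `(a + c) - (b + d)`. -/
theorem modeTerm_eq (τ : CXY) (pq : (ℕ × ℕ) × (ℕ × ℕ)) :
    modeTerm τ ⟨pq.2.1 - pq.2.2 + 1, pq⟩ = quadTerm τ pq := by
  obtain ⟨⟨a, b⟩, ⟨c, d⟩⟩ := pq
  have hτ : ofCXY τ 0 = τ := Pi.single_eq_same (M := fun _ : ℤ => CXY) 0 τ
  simp only [modeTerm, phiStarTerm, phiTerm, quadTerm]
  rw [if_pos (by ring), map_mul, map_mul, inLeft_elemSchur, inRight_elemSchur]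
  -- Both `1 - 1` and `-1 + 1` are the degree 0 in which `τ` sits.
  norm_num only [hτ]
  rw [inLeft_alphaMode, mul_mul_mul_comm, ← alphaTwo_mul_inRight, inLeft_elemSchur_mul,
    mul_inRight_elemSchur]
  congr 3
  push_cast
  ring

/-- At total weight `N`, the Schur factors bound `a` and `c`. The weight contributed by a negative
Heisenberg mode gives `b + 1 - i ≤ N'`, with `N'` the weight in the first factor; together with `d =
c - i + 1` this bounds `b + d`, and hence the mode `i`. -/
theorem locallyFinite_modeTerm (τ : CXY) : LocallyFinite (modeTerm τ) := by
  classical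
  intro d
  set N := Finsupp.weight (Sum.elim bosWt bosWt) d with hN
  have hinj : Function.Injective fun x : Σ _ : ℤ, (ℕ × ℕ) × (ℕ × ℕ) => (x.1, x.2) := by
    rintro ⟨i, p⟩ ⟨j, q⟩ h
    simp_all
  refine ((((Finset.Icc (1 - (N : ℤ)) (N + 1)) ×ˢ
    ((Finset.range (2 * N + 1) ×ˢ Finset.range (2 * N + 1)) ×ˢ
      (Finset.range (2 * N + 1) ×ˢ Finset.range (2 * N + 1)))).finite_toSet).preimage
      hinj.injOn).subset ?_
  intro x h
  simp only [Set.mem_ofPred_eq, modeTerm, inLeft_apply, inRight_apply] at h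
  rw [MvPowerSeries.coeff_mul] at h
  obtain ⟨q, hq, hne⟩ := Finset.exists_ne_zero_of_sum_ne_zero h
  obtain ⟨e, he, he0⟩ := weight_of_coeff_subst Sum.inl_injective (fun _ => rfl)
    (left_ne_zero_of_mul hne)
  obtain ⟨e', he', he0'⟩ := weight_of_coeff_subst Sum.inr_injective (fun _ => rfl)
    (right_ne_zero_of_mul hne)
  have h1 := phiStarTerm_bound he0
  have h2 := phiTerm_bound he0'
  have h3 := congrArg (Finsupp.weight (Sum.elim bosWt bosWt))
    (Finset.HasAntidiagonal.mem_antidiagonal.mp hq)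
  rw [map_add] at h3
  simp only [Set.mem_preimage, Finset.mem_coe, Finset.mem_product, Finset.mem_Icc, Finset.mem_range]
  omega

theorem hasSum_modeTerm {τ : CXY} (hτ : IsTau (ofCXY τ)) : HasSum (modeTerm τ) 0 := by
  have hs := (locallyFinite_modeTerm τ).hasSum.summable
  have h0 : HasSum (fun i : ℤ => tensor (phiStar i (ofCXY τ)) (phi (-i) (ofCXY τ)) 1 (-1)) 0 := by
    have h := (locallyFinite_omegaU (ofCXY τ) (ofCXY τ) 1 (-1)).hasSum
    have h' : omegaU (ofCXY τ) (ofCXY τ) 1 (-1) = 0 := by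
      rw [show omegaU (ofCXY τ) (ofCXY τ) = 0 from hτ]; rfl
    rw [← h']
    exact h
  -- The outer sum over modes is the Hirota equation; each inner sum is the product of the
  -- expansions of `φ*_i τ` and `φ_{-i} τ`.
  refine HasSum.sigma_of_hasSum h0 (fun i => ?_) hs
  have h1 := (locallyFinite_phiStarTerm i (ofCXY τ) 1).hasSum.map inLeft continuous_inLeft
  have h2 := (locallyFinite_phiTerm (-i) (ofCXY τ) (-1)).hasSum.map inRight continuous_inRight
  have h3 := h1.mul h2 (hs.comp_injective (i := Sigma.mk i) sigma_mk_injective)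
  rw [inLeft_apply, inRight_apply] at h3
  exact h3

theorem hasSum_quadTerm {τ : CXY} (hτ : IsTau (ofCXY τ)) : HasSum (quadTerm τ) 0 := by
  let g : (ℕ × ℕ) × (ℕ × ℕ) → Σ _ : ℤ, (ℕ × ℕ) × (ℕ × ℕ) :=
    fun pq => ⟨pq.2.1 - pq.2.2 + 1, pq⟩
  have hg : Function.Injective g := by
    intro p q h
    simpa [g] using (Sigma.mk.inj_iff.mp h).2
  have h := (hg.hasSum_iff (f := modeTerm τ) fun x hx => modeTerm_of_ne fun he => hx ⟨x.2, by
    obtain ⟨i, pq⟩ := x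
    simp only [g, Sigma.mk.injEq, heq_eq_eq, and_true]
    simp only at he
    omega⟩).mpr (hasSum_modeTerm hτ)
  exact h.congr_fun fun pq => (modeTerm_eq τ pq).symm

/-- The summands of the Hirota equation in the variables `x', y', x'', y''`. -/
def groupedTerm (τ : CXY) (ij : ℕ × ℕ) : CTwo :=
  elemSchur (leftXY + rightXY) ij.1 *
    alphaTwo ((ij.1 : ℤ) - ij.2) (elemSchur (leftD + rightD) ij.2 (tauTwo τ))

/-- The terms are partitioned by `(a + c, b + d)`. Each class is finite and shares one Heisenberg
mode, which can be factored out by linearity before `elemSchur_add` is applied to both Schur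
factors. -/
theorem hasSum_groupedTerm {τ : CXY} (hτ : IsTau (ofCXY τ)) : HasSum (groupedTerm τ) 0 := by
  let s : ℕ × ℕ → Finset ((ℕ × ℕ) × (ℕ × ℕ)) := fun ij =>
    Finset.HasAntidiagonal.antidiagonal ij.1 ×ˢ Finset.HasAntidiagonal.antidiagonal ij.2
  let g : (Σ ij, s ij) → (ℕ × ℕ) × (ℕ × ℕ) := fun x => Equiv.prodProdProdComm ℕ ℕ ℕ ℕ x.2.1
  have hg : Function.Bijective g := by
    constructor
    · rintro ⟨⟨i, j⟩, ⟨p, hp⟩⟩ ⟨⟨i', j'⟩, ⟨q, hq⟩⟩ h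
      have hpq : p = q := (Equiv.injective _) h
      subst hpq
      simp only [s, Finset.mem_product, Finset.HasAntidiagonal.mem_antidiagonal] at hp hq
      obtain ⟨rfl, rfl⟩ := hp
      obtain ⟨rfl, rfl⟩ := hq
      rfl
    · rintro ⟨⟨a, b⟩, ⟨c, d⟩⟩
      exact ⟨⟨(a + c, b + d), ⟨((a, c), (b, d)), by simp [s]⟩⟩, rfl⟩
  have h := (Equiv.ofBijective g hg).hasSum_iff.mpr (hasSum_quadTerm hτ)
  refine HasSum.sigma h fun ij => ?_
  have hf := (s ij).hasSum fun x => quadTerm τ (Equiv.prodProdProdComm ℕ ℕ ℕ ℕ x)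
  suffices hsum : groupedTerm τ ij = ∑ x ∈ s ij, quadTerm τ (Equiv.prodProdProdComm ℕ ℕ ℕ ℕ x) by
    rw [hsum]
    exact hf
  simp only [groupedTerm, s]
  rw [elemSchur_add (fun _ _ => Commute.all _ _), elemSchur_add commute_leftD_rightD,
    LinearMap.sum_apply, map_sum, Finset.sum_mul_sum, Finset.sum_product]
  refine Finset.sum_congr rfl fun p hp => Finset.sum_congr rfl fun q hq => ?_
  simp only [quadTerm, Equiv.prodProdProdComm_apply, Module.End.mul_apply]
  rw [Finset.HasAntidiagonal.mem_antidiagonal.mp hp, Finset.HasAntidiagonal.mem_antidiagonal.mp hq]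

/-! ### Passage to the variables of the bilinear equations -/

/-- The substitution `(x', y', x'', y'') ↦ (x̄ + λ, ȳ + μ, x̄ - λ, ȳ - μ)`. -/
def pairVar : BosVar ⊕ BosVar → CHir := Sum.elim plusVar minusVar

theorem hasSubst_pairVar : MvPowerSeries.HasSubst pairVar where
  const_coeff v := by
    cases v with
    | inl v => exact hasSubst_plusVar.const_coeff v
    | inr v => exact hasSubst_minusVar.const_coeff v
  coeff_zero d := by
    refine (((hasSubst_plusVar.coeff_zero d).image Sum.inl).union
      ((hasSubst_minusVar.coeff_zero d).image Sum.inr)).subset ?_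
    rintro (v | v) hv
    · exact Or.inl ⟨v, hv, rfl⟩
    · exact Or.inr ⟨v, hv, rfl⟩

/-- `F(x', y', x'', y'') ↦ F(x̄ + λ, ȳ + μ, x̄ - λ, ȳ - μ)`. -/
def toHir : CTwo →ₐ[ℂ] CHir := MvPowerSeries.substAlgHom hasSubst_pairVar

theorem toHir_apply (F : CTwo) : toHir F = MvPowerSeries.subst pairVar F :=
  MvPowerSeries.substAlgHom_apply hasSubst_pairVar F

theorem continuous_toHir : Continuous toHir :=
  (continuous_subst hasSubst_pairVar).congr fun F => (toHir_apply F).symm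

theorem toHir_X (v : BosVar ⊕ BosVar) : toHir (MvPowerSeries.X v) = pairVar v :=
  MvPowerSeries.substAlgHom_X hasSubst_pairVar v

theorem toHir_tauTwo (τ : CXY) : toHir (tauTwo τ) = twoPoint τ := by
  rw [tauTwo, map_mul, twoPoint, mul_comm, toHir_apply, toHir_apply, inLeft_apply, inRight_apply,
    MvPowerSeries.subst_comp_subst_apply hasSubst_inl hasSubst_pairVar,
    MvPowerSeries.subst_comp_subst_apply hasSubst_inr hasSubst_pairVar]
  simp only [MvPowerSeries.subst_X hasSubst_pairVar]
  rfl

theorem D_toHir (w : HirVar) (E : Module.End ℂ CTwo) (hE : Continuous E)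
    (hmul : ∀ F G, E (F * G) = F * E G + G * E F)
    (hX : ∀ v, D w (pairVar v) = toHir (E (MvPowerSeries.X v))) (F : CTwo) :
    D w (toHir F) = toHir (E F) := by
  simp only [toHir_apply] at hX ⊢
  exact D_subst hasSubst_pairVar w E hE hmul hX F

/-- Chain rule: `λ_n` enters `x'_n` with sign `+` and `x''_n` with sign `-`. -/
theorem D_vlam_toHir (n : ℕ+) (F : CTwo) : D (vlam n) (toHir F) =
    toHir (D (Sum.inl (BosVar.x n)) F - D (Sum.inr (BosVar.x n)) F) := by
  classical
  refine D_toHir (vlam n) (D (Sum.inl (BosVar.x n)) - D (Sum.inr (BosVar.x n)))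
    ((continuous_D _).sub (continuous_D _)) (fun F G => ?_) (fun v => ?_) F
  · simp only [LinearMap.sub_apply, D_mul]
    ring
  · rcases v with (m | m) | (m | m) <;>
      simp [pairVar, plusVar, minusVar, D, MvPowerSeries.pderiv_X, Pi.single_apply,
        apply_ite toHir]

theorem D_vmu_toHir (n : ℕ+) (F : CTwo) : D (vmu n) (toHir F) =
    toHir (D (Sum.inl (BosVar.y n)) F - D (Sum.inr (BosVar.y n)) F) := by
  classical
  refine D_toHir (vmu n) (D (Sum.inl (BosVar.y n)) - D (Sum.inr (BosVar.y n)))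
    ((continuous_D _).sub (continuous_D _)) (fun F G => ?_) (fun v => ?_) F
  · simp only [LinearMap.sub_apply, D_mul]
    ring
  · rcases v with (m | m) | (m | m) <;>
      simp [pairVar, plusVar, minusVar, D, MvPowerSeries.pderiv_X, Pi.single_apply,
        apply_ite toHir]

theorem D_vxbar_toHir (n : ℕ+) (F : CTwo) : D (vxbar n) (toHir F) =
    toHir (D (Sum.inl (BosVar.x n)) F + D (Sum.inr (BosVar.x n)) F) := by
  classical
  refine D_toHir (vxbar n) (D (Sum.inl (BosVar.x n)) + D (Sum.inr (BosVar.x n)))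
    ((continuous_D _).add (continuous_D _)) (fun F G => ?_) (fun v => ?_) F
  · simp only [LinearMap.add_apply, D_mul]
    ring
  · rcases v with (m | m) | (m | m) <;>
      simp [pairVar, plusVar, minusVar, D, MvPowerSeries.pderiv_X, Pi.single_apply,
        apply_ite toHir]

/-- The substitution `(x', y', x'', y'') ↦ (x̄ + λ, ȳ + μ, x̄ - λ, ȳ - μ)` followed by the shift of
`(λ, μ)` by `(x, y)`. -/
def toShifted : CTwo →ₐ[ℂ] CHir := expShiftHom.comp toHir

theorem toShifted_apply (F : CTwo) : toShifted F = expShift (toHir F) := rfl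

theorem D_vlam_toShifted (n : ℕ+) (F : CTwo) : D (vlam n) (toShifted F) =
    toShifted (D (Sum.inl (BosVar.x n)) F - D (Sum.inr (BosVar.x n)) F) := by
  rw [toShifted_apply, D_expShift (by simp) (by simp), D_vlam_toHir, toShifted_apply]

theorem D_vmu_toShifted (n : ℕ+) (F : CTwo) : D (vmu n) (toShifted F) =
    toShifted (D (Sum.inl (BosVar.y n)) F - D (Sum.inr (BosVar.y n)) F) := by
  rw [toShifted_apply, D_expShift (by simp) (by simp), D_vmu_toHir, toShifted_apply]

theorem D_vxbar_toShifted (n : ℕ+) (F : CTwo) : D (vxbar n) (toShifted F) =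
    toShifted (D (Sum.inl (BosVar.x n)) F + D (Sum.inr (BosVar.x n)) F) := by
  rw [toShifted_apply, D_expShift (by simp) (by simp), D_vxbar_toHir, toShifted_apply]

/-- The derivatives must be transported while `λ, μ` are still free, that is, before evaluation at
0. There `-∂_λ + ∂_μ` corresponds to `-(∂x' - ∂x'') + (∂y' - ∂y'')`, which is `n` times `leftD +
rightD`. -/
theorem elemSchur_tildeD_toShifted (k : ℕ) (F : CTwo) :
    elemSchur tildeD k (toShifted F) = toShifted (elemSchur (leftD + rightD) k F) := by
  refine (elemSchur_intertwine toShifted.toLinearMap (fun n v => ?_) k F).symm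
  simp only [AlgHom.toLinearMap_apply, tildeD, LinearMap.add_apply, LinearMap.neg_apply,
    LinearMap.smul_apply, D_vlam_toShifted, D_vmu_toShifted, Pi.add_apply, leftD, rightD,
    LinearMap.sub_apply, map_add, map_neg, map_smul, map_sub]
  module

theorem toShifted_X_left_x (n : ℕ+) : toShifted (MvPowerSeries.X (Sum.inl (BosVar.x n))) =
    MvPowerSeries.X (vxbar n) + (MvPowerSeries.X (vlam n) + MvPowerSeries.X (vx n)) := by
  rw [toShifted_apply, toHir_X]
  change expShiftHom (MvPowerSeries.X (vxbar n) + MvPowerSeries.X (vlam n)) = _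
  rw [map_add, expShiftHom_apply, expShiftHom_apply,
    expShift_of_shiftOp (shiftOp_X_of_ne (by simp) (by simp)),
    expShift_of_shiftOp_shiftOp, shiftOp_X_vlam]
  rw [shiftOp_X_vlam, shiftOp_X_of_ne (by simp) (by simp)]

theorem toShifted_leftXY_add_rightXY (n : ℕ+) : toShifted ((leftXY + rightXY) n) =
    twoXY n + (2 : ℂ) • (MvPowerSeries.X (vlam n) + MvPowerSeries.X (vmu n)) := by
  have h : toHir ((leftXY + rightXY) n) =
      (2 : ℂ) • (MvPowerSeries.X (vlam n) + MvPowerSeries.X (vmu n)) := by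
    simp only [Pi.add_apply, leftXY, rightXY, map_add, map_neg, toHir_X, pairVar, Sum.elim_inl,
      Sum.elim_inr, plusVar, minusVar]
    module
  rw [toShifted_apply, h, ← expShiftHom_apply, map_smul, map_add, expShiftHom_apply,
    expShiftHom_apply, expShift_of_shiftOp_shiftOp, expShift_of_shiftOp_shiftOp, shiftOp_X_vlam,
    shiftOp_X_vmu, twoXY]
  · module
  · rw [shiftOp_X_vmu, shiftOp_X_of_ne (by simp) (by simp)]
  · rw [shiftOp_X_vlam, shiftOp_X_of_ne (by simp) (by simp)]

/-- `atZero` as an algebra homomorphism. -/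
def atZeroHom : CHir →ₐ[ℂ] MvPowerSeries EqVar ℂ :=
  MvPowerSeries.killCompl (Function.Embedding.inl : EqVar ↪ HirVar)

theorem atZeroHom_apply (F : CHir) : atZeroHom F = atZero F := rfl

theorem atZeroHom_X_inl (v : EqVar) :
    atZeroHom (MvPowerSeries.X (Sum.inl v)) = MvPowerSeries.X v :=
  MvPowerSeries.killCompl_X (e := (Function.Embedding.inl : EqVar ↪ HirVar)) v

theorem atZeroHom_X_inr (v : BosVar) : atZeroHom (MvPowerSeries.X (Sum.inr v)) = 0 :=
  MvPowerSeries.killCompl_X_eq_zero (by simp)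

/-- `F(x', y', x'', y'') ↦ F(x̄ + x, ȳ + y, x̄ - x, ȳ - y)`. -/
def toEq : CTwo →ₐ[ℂ] MvPowerSeries EqVar ℂ := atZeroHom.comp toShifted

theorem toEq_apply (F : CTwo) : toEq F = atZeroHom (toShifted F) := rfl

theorem continuous_toEq : Continuous toEq :=
  (continuous_killCompl _).comp (continuous_expShift.comp continuous_toHir)

/-- `2 x_n + 2 y_n` in `ℂ[[x, y, x̄, ȳ]]`. -/
def eqTwoXY (n : ℕ+) : MvPowerSeries EqVar ℂ :=
  (2 : ℂ) • MvPowerSeries.X (EqVar.x n) + (2 : ℂ) • MvPowerSeries.X (EqVar.y n)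

theorem atZeroHom_elemSchur_twoXY (k : ℕ) :
    atZeroHom (elemSchur twoXY k) = elemSchur eqTwoXY k := by
  rw [map_elemSchur]
  congr 1
  funext n
  simp only [twoXY, eqTwoXY, map_add, map_smul, atZeroHom_X_inl]

theorem toEq_elemSchur (k : ℕ) :
    toEq (elemSchur (leftXY + rightXY) k) = elemSchur eqTwoXY k := by
  rw [map_elemSchur]
  congr 1
  funext n
  rw [toEq_apply, toShifted_leftXY_add_rightXY]
  simp only [twoXY, eqTwoXY, map_add, map_smul, atZeroHom_X_inl, atZeroHom_X_inr, add_zero,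
    smul_zero]

/-- For `i > j`, half of `(∂x' - ∂x'') + (∂x' + ∂x'')` is `∂x'`; for `i < j`, `x'` becomes `x̄ + λ +
x`, hence `x + x̄` at `λ = 0`. For `i = j` both sides vanish. -/
theorem atZeroHom_bracket (i j : ℕ) (F : CTwo) :
    atZeroHom (bracket i j (toShifted F)) = toEq (alphaTwo ((i : ℤ) - j) F) := by
  simp only [bracket, alphaTwo, LinearMap.add_apply, LinearMap.mulLeft_apply, map_add, map_mul,
    map_smul, neg_sub, ← toEq_apply]
  rw [add_comm]
  congr 1
  · unfold extZ
    split_ifs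
    · rw [LinearMap.add_apply, D_vlam_toShifted, D_vxbar_toShifted, toEq_apply, ← map_smul,
        ← map_add, ← map_smul]
      congr 2
      module
    · simp
  · rw [← smul_mul_assoc]
    congr 1
    unfold extZ
    split_ifs with h
    · rw [map_smul, toEq_apply, toShifted_X_left_x]
      simp only [map_add, atZeroHom_X_inl, atZeroHom_X_inr, zero_add]
      rw [add_comm]
      congr 1
      have h1 : (((j : ℤ) - i).toNat.toPNat (by omega) : ℕ) = ((j : ℤ) - i).toNat := rfl
      have h2 : ((((j : ℤ) - i).toNat : ℤ) : ℂ) = (((j : ℤ) - i : ℤ) : ℂ) :=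
        congrArg _ (Int.toNat_of_nonneg h.le)
      rw [h1]
      exact h2.symm
    · simp

theorem atZero_hirotaTerm (τ : CXY) (i j : ℕ) :
    atZero (hirotaTerm τ i j) = toEq (groupedTerm τ (i, j)) := by
  rw [← atZeroHom_apply, hirotaTerm, ← toHir_tauTwo, ← toShifted_apply, elemSchur_tildeD_toShifted,
    map_mul, atZeroHom_bracket, atZeroHom_elemSchur_twoXY, groupedTerm, map_mul, toEq_elemSchur]

/-! ### Local finiteness of the bilinear equations -/

/-- The grading in which the variables with index `n` have weight `n`. -/
def eqWt : EqVar → ℕ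
  | EqVar.x n => n
  | EqVar.y n => n
  | EqVar.xbar n => n
  | EqVar.ybar n => n

theorem lowWt_eqTwoXY (n : ℕ+) : LowWt eqWt n (eqTwoXY n) :=
  ((lowWt_X eqWt (EqVar.x n)).smul _).add ((lowWt_X eqWt (EqVar.y n)).smul _)

/-- The subtraction is truncated. For `i < j` the bracket is multiplication by a variable of index
`j - i`; otherwise it may differentiate and lower weights, but nothing is claimed. -/
theorem lowWt_atZeroHom_bracket (i j : ℕ) (F : CHir) :
    LowWt eqWt (j - i) (atZeroHom (bracket i j F)) := by
  by_cases h : i < j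
  · have h1 : 0 < (j : ℤ) - i := by omega
    have h2 : ¬ 0 < (i : ℤ) - j := by omega
    rw [bracket, extZ, dif_pos h1, extZ, dif_neg h2, LinearMap.zero_apply, smul_zero, add_zero,
      map_smul, map_mul, map_add, atZeroHom_X_inl, atZeroHom_X_inl]
    have hz : LowWt eqWt 0 (atZeroHom F) := fun _ _ => Nat.zero_le _
    have hn : (((j : ℤ) - i).toNat.toPNat (by omega) : ℕ) = j - i := by
      change ((j : ℤ) - i).toNat = j - i
      omega
    have hx := (lowWt_X eqWt (EqVar.x (((j : ℤ) - i).toNat.toPNat (by omega)))).add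
      (lowWt_X eqWt (EqVar.xbar (((j : ℤ) - i).toNat.toPNat (by omega))))
    rw [show eqWt (EqVar.x (((j : ℤ) - i).toNat.toPNat (by omega))) = j - i from hn] at hx
    exact (hx.mul hz).smul _
  · intro d _
    omega

theorem locallyFinite_hirotaTerm (τ : CXY) :
    LocallyFinite fun ij : ℕ × ℕ => atZero (hirotaTerm τ ij.1 ij.2) := by
  intro d
  refine (Finset.range (Finsupp.weight eqWt d + 1) ×ˢ
    Finset.range (Finsupp.weight eqWt d + 1)).finite_toSet.subset fun ij h => ?_
  simp only [Set.mem_ofPred_eq, ← atZeroHom_apply, hirotaTerm, map_mul,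
    atZeroHom_elemSchur_twoXY] at h
  -- The combined weight is at least `i + (j - i) = max i j`, which bounds both indices.
  have := ((lowWt_elemSchur lowWt_eqTwoXY ij.1).mul (lowWt_atZeroHom_bracket ij.1 ij.2 _)) d h
  simp only [Finset.coe_product, Set.mem_prod, Finset.mem_coe, Finset.mem_range]
  omega

end BosonicTau

end

open scoped MvPowerSeries.WithPiTopology in
theorem proposition3p4 (τ : BosonicTau.CXY)
    (hτ : BosonicTau.IsTau (BosonicTau.ofCXY τ)) :
    BosonicTau.LocallyFinite
        (fun ij : ℕ × ℕ => BosonicTau.atZero (BosonicTau.hirotaTerm τ ij.1 ij.2)) ∧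
      BosonicTau.formalSum
        (fun ij : ℕ × ℕ => BosonicTau.atZero (BosonicTau.hirotaTerm τ ij.1 ij.2)) = 0 := by
  have hfin := BosonicTau.locallyFinite_hirotaTerm τ
  refine ⟨hfin, hfin.hasSum.unique ?_⟩
  have h := (BosonicTau.hasSum_groupedTerm hτ).map BosonicTau.toEq BosonicTau.continuous_toEq
  rw [map_zero] at h
  exact h.congr_fun fun ij => BosonicTau.atZero_hirotaTerm τ ij.1 ij.2
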